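/- Fix $\beta>0$, $h\in\mathbb R$, $0<p<1/2$ and a threshold $S\in(-1,1)$. Let $n$ run through a sequence of positive integers tending to infinity such that $n(1+S)/2$ is never an integer, and for each such $n$ let $G_n$ be an undirected graph on $n$ vertices with adjacency matrix $A_n$. Let $\boldsymbol X=(X_1,\dots,X_n)\in\{-1,1\}^n$ be a random vector with the Ising distribution $$\mathbb P(\boldsymbol X=\boldsymbol x)=\frac{\exp(\beta\,\boldsymbol x^TA_n\boldsymbol x+h\,\boldsymbol 1^T\boldsymbol x)}{Z_n(\beta,h)},\qquad Z_n(\beta,h)=\sum_{\boldsymbol x\in\{-1,1\}^n}\exp(\beta\,\boldsymbol x^TA_n\boldsymbol x+h\,\boldsymbol 1^T\boldsymbol x),$$ and, given $\boldsymbol X$, let $Y_1,\dots,Y_n\in\{-1,1\}$ be conditionally independent with $Y_i=-X_i$ with probability $p$ and $Y_i=X_i$ with probability $1-p$. Write $\overline{X_n}=\frac1n\sum_{i=1}^nX_i$, $\overline{Y_n}=\frac1n\sum_{i=1}^nY_i$, and let $$m=\operatorname{sign}(\overline{X_n}-S),\qquad \hat m=\operatorname{sign}(\overline{Y_n}-(1-2p)S),\qquad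 P_e^{(n)}=\mathbb P(m\ne\hat m)$$ be the supermajority sentiment, its detector and the detection error probability (with $\operatorname{sign}(0)=0$). Then \begin{align*} \liminf_{n\to\infty}P_e^{(n)}&=\liminf_{n\to\infty}\mathbb E\left[Q\left(D_p\sqrt n\,|\overline{X_n}-S|\right)\right],\\ \limsup_{n\to\infty}P_e^{(n)}&=\limsup_{n\to\infty}\mathbb E\left[Q\left(D_p\sqrt n\,|\overline{X_n}-S|\right)\right], \end{align*} where $D_p=\dfrac{1-2p}{\sqrt{4p(1-p)}}$ and $Q(x)=\dfrac1{\sqrt{2\pi}}\displaystyle\int_x^\infty e^{-t^2/2}\,dt$. -/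

import Mathlib

open MeasureTheory Filter

noncomputable section

namespace Sentiment

/-- A configuration of sentiments: each of the `n` members has a value in `{-1, 1}`. -/
abbrev Spins (n : ℕ) : Type := Fin n → ℤˣ

/-- The configuration as a real vector. -/
def vec {n : ℕ} (x : Spins n) : Fin n → ℝ := fun i => ((x i : ℤ) : ℝ)

/-- The sample average `(1/n) ∑ᵢ xᵢ`. -/
def avg {n : ℕ} (x : Spins n) : ℝ := (∑ i, vec x i) / n

open Classical in
/-- The unnormalized Ising weight `exp (β xᵀ A x + h 1ᵀ x)`, where `A` is the adjacency matrix. -/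
def isingWeight {n : ℕ} (G : SimpleGraph (Fin n)) (β h : ℝ) (x : Spins n) : ℝ :=
  Real.exp (β * (vec x ⬝ᵥ (G.adjMatrix ℝ).mulVec (vec x)) + h * ∑ i, vec x i)

/-- The partition function `Z(β, h)`. -/
def partitionFunction {n : ℕ} (G : SimpleGraph (Fin n)) (β h : ℝ) : ℝ :=
  ∑ x : Spins n, isingWeight G β h x

/-- The Ising probability mass function. -/
def isingPrior {n : ℕ} (G : SimpleGraph (Fin n)) (β h : ℝ) (x : Spins n) : ℝ :=
  isingWeight G β h x / partitionFunction G β h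

/-- Transition probability of `n` independent uses of the binary symmetric channel with
cross-over probability `p`. -/
def channelProb {n : ℕ} (p : ℝ) (x y : Spins n) : ℝ :=
  ∏ i, if y i = x i then 1 - p else p

/-- `X` (sentiments) and `Y` (measured sentiments) are random vectors on `(Ω, P)` such that `X`
has the Ising law and, given `X`, the coordinates of `Y` are independent outputs of the binary
symmetric channel with inputs the coordinates of `X`. -/
structure IsSentimentModel {Ω : Type*} [MeasurableSpace Ω] (P : Measure Ω) {n : ℕ}
    (G : SimpleGraph (Fin n)) (β h p : ℝ) (X Y : Ω → Spins n) : Prop where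
  measurable_X : Measurable X
  measurable_Y : Measurable Y
  law_X : ∀ x, P.real {ω | X ω = x} = isingPrior G β h x
  law_Y : ∀ x y, P.real {ω | X ω = x ∧ Y ω = y} = P.real {ω | X ω = x} * channelProb p x y

/-- The supermajority sentiment `m = sign (x̄ - S)`. -/
def supermajority {n : ℕ} (S : ℝ) (x : Spins n) : SignType :=
  SignType.sign (avg x - S)

/-- The detector `m̂ = sign (ȳ - (1 - 2p) S)`. -/
def detector {n : ℕ} (p S : ℝ) (y : Spins n) : SignType :=
  SignType.sign (avg y - (1 - 2 * p) * S)

/-- The detection error probability `P(m ≠ m̂)`. -/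
def errorProb {Ω : Type*} [MeasurableSpace Ω] (P : Measure Ω) {n : ℕ} (p S : ℝ)
    (X Y : Ω → Spins n) : ℝ :=
  P.real {ω | supermajority S (X ω) ≠ detector p S (Y ω)}

/-- The standard Gaussian tail `Q(x) = (2π)^(-1/2) ∫_x^∞ exp(-t²/2) dt`. -/
def gaussianQ (x : ℝ) : ℝ :=
  1 / √(2 * Real.pi) * ∫ t in Set.Ioi x, Real.exp (-t ^ 2 / 2)

/-- `D_p = (1 - 2p) / √(4 p (1 - p))`. -/
def Dp (p : ℝ) : ℝ := (1 - 2 * p) / √(4 * p * (1 - p))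

end Sentiment

end

noncomputable section

namespace Sentiment

open ProbabilityTheory Topology Asymptotics

/-! ### Sequences with vanishing difference -/

/-! Write the channel as multiplicative noise, `Y = X * f` with i.i.d. flips `f`. Given `X = x`, let
`s = sign (avg x - S)`, which is `±1` because `n(1+S)/2` is not an integer. Multiplying by `s` and
normalizing turns the error event into `n^(-1/2) ∑ s xᵢ Wᵢ ≤ -D_p √n |avg x - S|`, with `Wᵢ` the
standardized flips (`error_iff`). The signs `s xᵢ` do not affect the Gaussian limit, so a CLT holds
for every choice of configurations `x`.

The threshold on the right moves with `n`, so convergence must be uniform in the argument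
(`tendstoUniformly_cdf`). Applying the CLT along worst configurations makes it uniform in `x` too
(`eventually_forall_abs_condErrorProb_sub_lt`). Averaging over `X` then gives `P_e - E[Q] → 0`, so
both sequences share their liminf and limsup. -/

lemma liminf_le_liminf_of_tendsto_sub {u v : ℕ → ℝ} (huv : Tendsto (fun k => u k - v k) atTop (𝓝 0))
    (hu : ∀ k, u k ∈ Set.Icc (0 : ℝ) 1) (hv : ∀ k, v k ∈ Set.Icc (0 : ℝ) 1) :
    liminf u atTop ≤ liminf v atTop := by
  have hbu : IsBoundedUnder (· ≥ ·) atTop u := isBoundedUnder_of ⟨0, fun k => (hu k).1⟩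
  have hbv : IsBoundedUnder (· ≥ ·) atTop v := isBoundedUnder_of ⟨0, fun k => (hv k).1⟩
  have hcv : IsCoboundedUnder (· ≥ ·) atTop v :=
    IsBoundedUnder.isCoboundedUnder_ge (isBoundedUnder_of ⟨1, fun k => (hv k).2⟩)
  refine le_of_forall_pos_le_add fun ε hε => ?_
  rw [← liminf_add_const atTop v ε hcv hbv]
  refine liminf_le_liminf ?_ hbu
    (IsBoundedUnder.isCoboundedUnder_ge (isBoundedUnder_of ⟨1 + ε, fun k => ?_⟩))
  · filter_upwards [huv.eventually_le_const hε] with k hk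
    linarith
  · linarith [(hv k).2]

lemma limsup_le_limsup_of_tendsto_sub {u v : ℕ → ℝ} (huv : Tendsto (fun k => u k - v k) atTop (𝓝 0))
    (hu : ∀ k, u k ∈ Set.Icc (0 : ℝ) 1) (hv : ∀ k, v k ∈ Set.Icc (0 : ℝ) 1) :
    limsup u atTop ≤ limsup v atTop := by
  have hbv : IsBoundedUnder (· ≤ ·) atTop v := isBoundedUnder_of ⟨1, fun k => (hv k).2⟩
  have hcu : IsCoboundedUnder (· ≤ ·) atTop u :=
    IsBoundedUnder.isCoboundedUnder_le (isBoundedUnder_of ⟨0, fun k => (hu k).1⟩)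
  have hcv : IsCoboundedUnder (· ≤ ·) atTop v :=
    IsBoundedUnder.isCoboundedUnder_le (isBoundedUnder_of ⟨0, fun k => (hv k).1⟩)
  refine le_of_forall_pos_le_add fun ε hε => ?_
  rw [← limsup_add_const atTop v ε hbv hcv]
  refine limsup_le_limsup ?_ hcu (isBoundedUnder_of ⟨1 + ε, fun k => ?_⟩)
  · filter_upwards [huv.eventually_le_const hε] with k hk
    linarith
  · linarith [(hv k).2]

/-! ### Uniform convergence of distribution functions -/

/-- **Pólya's theorem**: pointwise convergence of distribution functions to a continuous
distribution function is uniform. -/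
theorem tendstoUniformly_cdf {μ : ℕ → Measure ℝ} {ν : Measure ℝ}
    (hν : Continuous (cdf ν))
    (h : ∀ x, Tendsto (fun k => cdf (μ k) x) atTop (𝓝 (cdf ν x))) :
    TendstoUniformly (fun k => cdf (μ k)) (cdf ν) atTop := by
  rw [Metric.tendstoUniformly_iff]
  intro ε hε
  -- The levels `j / m` have mesh below `ε / 2`; the other `ε / 2` is the error allowed at the
  -- quantiles `q j`.
  obtain ⟨m, hm⟩ := exists_nat_gt (2 / ε)
  have hm0 : (0 : ℝ) < m := lt_trans (by positivity) hm
  have hmε : 1 / (m : ℝ) < ε / 2 := by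
    rw [div_lt_iff₀ hε] at hm
    rw [div_lt_iff₀ hm0]
    linarith
  -- Levels 0 and 1 need not be attained; the bounds `0 ≤ cdf ≤ 1` replace them below.
  have quantile : ∀ j : ℕ, ∃ q, 0 < j → j < m → cdf ν q = j / m := by
    intro j
    by_cases hj : 0 < j ∧ j < m
    · obtain ⟨a, ha⟩ := ((tendsto_cdf_atBot ν).eventually_lt_const
        (show (0 : ℝ) < j / m by have := hj.1; positivity)).exists
      obtain ⟨b, hb⟩ := ((tendsto_cdf_atTop ν).eventually_const_lt
        (show (j : ℝ) / m < 1 by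
          rw [div_lt_one hm0]; exact_mod_cast hj.2)).exists
      obtain ⟨q, hq⟩ := mem_range_of_exists_le_of_exists_ge hν ⟨a, ha.le⟩ ⟨b, hb.le⟩
      exact ⟨q, fun _ _ => hq⟩
    · exact ⟨0, fun h1 h2 => absurd ⟨h1, h2⟩ hj⟩
  choose q hq using quantile
  have hev : ∀ᶠ k in atTop, ∀ j ∈ Finset.range m, |cdf (μ k) (q j) - cdf ν (q j)| < ε / 2 := by
    rw [Filter.eventually_all_finset]
    intro j _
    exact (Metric.tendsto_nhds.1 (h (q j))) _ (half_pos hε)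
  filter_upwards [hev] with k hk x
  have hlo := cdf_nonneg ν x
  have hhi := cdf_le_one ν x
  rw [dist_comm, Real.dist_eq, abs_lt]
  constructor
  · rcases le_or_gt (cdf ν x) (1 / m) with hx | hx
    · linarith [cdf_nonneg (μ k) x]
    -- The ceiling makes `j / m < cdf ν x` strict, which forces `j < m` even if `cdf ν x = 1`, and
    -- `q j ≤ x`.
    obtain ⟨j, hj⟩ : ∃ j : ℕ, ⌈cdf ν x * m⌉₊ = j + 1 := by
      refine Nat.exists_eq_succ_of_ne_zero (Nat.ceil_pos.2 ?_).ne'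
      exact mul_pos (lt_trans (by positivity) hx) hm0
    have hj1 : (j : ℝ) / m < cdf ν x := by
      rw [div_lt_iff₀ hm0]
      exact Nat.lt_ceil.1 (by omega)
    have hj2 : cdf ν x ≤ j / m + 1 / m := by
      rw [← add_div, le_div_iff₀ hm0]
      exact_mod_cast hj ▸ Nat.le_ceil (cdf ν x * m)
    have hjm : j < m := by
      have := hj1.trans_le hhi
      rw [div_lt_one hm0] at this
      exact_mod_cast this
    have hj0 : 0 < j := by
      rcases Nat.eq_zero_or_pos j with rfl | h
      · simp only [Nat.cast_zero, zero_div, zero_add] at hj2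
        linarith
      · exact h
    have hqj := hq j hj0 hjm
    have hle : q j ≤ x := by
      by_contra hcon
      linarith [monotone_cdf ν (not_le.1 hcon).le]
    have h2 := (abs_lt.1 (hk j (Finset.mem_range.2 hjm))).1
    linarith [monotone_cdf (μ k) hle]
  · obtain ⟨j, hj1, hj2⟩ : ∃ j : ℕ, (j : ℝ) / m ≤ cdf ν x ∧ cdf ν x < (j + 1 : ℝ) / m := by
      refine ⟨⌊cdf ν x * m⌋₊, ?_, ?_⟩
      · rw [div_le_iff₀ hm0]
        exact Nat.floor_le (by positivity)
      · rw [lt_div_iff₀ hm0]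
        exact Nat.lt_floor_add_one _
    have hsplit : ((j : ℝ) + 1) / m = j / m + 1 / m := add_div _ _ _
    rcases lt_or_ge (j + 1) m with hjm | hjm
    · have hqj := hq (j + 1) (Nat.succ_pos j) hjm
      push_cast at hqj
      have hle : x ≤ q (j + 1) := by
        by_contra hcon
        linarith [monotone_cdf ν (not_le.1 hcon).le]
      have h2 := (abs_lt.1 (hk (j + 1) (Finset.mem_range.2 hjm))).2
      linarith [monotone_cdf (μ k) hle]
    · have hone : (1 : ℝ) ≤ (j + 1) / m := by
        rw [le_div_iff₀ hm0, one_mul]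
        exact_mod_cast hjm
      linarith [cdf_le_one (μ k) x]

/-! ### The standard Gaussian law -/

/-- The jump of a distribution function at a point is the mass of that point, and the Gaussian has
no atoms. -/
lemma continuous_cdf_gaussianReal : Continuous (cdf (gaussianReal 0 1)) := by
  have : NullSingletonClass (gaussianReal 0 1) := nullSingletonClass_gaussianReal one_ne_zero
  rw [continuous_iff_continuousAt]
  intro x
  rw [(monotone_cdf (gaussianReal 0 1)).continuousAt_iff_leftLim_eq_rightLim,
    StieltjesFunction.rightLim_eq]
  have h := (cdf (gaussianReal 0 1)).measure_singleton x
  rw [measure_cdf, measure_singleton, eq_comm, ENNReal.ofReal_eq_zero] at h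
  exact le_antisymm ((monotone_cdf _).leftLim_le le_rfl) (by linarith)

lemma gaussianQ_eq_cdf (x : ℝ) : gaussianQ x = cdf (gaussianReal 0 1) (-x) := by
  have h1 : gaussianQ x = (gaussianReal 0 1).real (Set.Ioi x) := by
    rw [measureReal_def, gaussianReal_apply_eq_integral _ one_ne_zero,
      ENNReal.toReal_ofReal (integral_nonneg fun _ => gaussianPDFReal_nonneg _ _ _)]
    simp [gaussianQ, gaussianPDFReal, integral_const_mul]
  have : NullSingletonClass (gaussianReal 0 1) := nullSingletonClass_gaussianReal one_ne_zero
  have h2 : (gaussianReal 0 1).map (fun y => -y) = gaussianReal 0 1 := by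
    rw [gaussianReal_map_neg, neg_zero]
  have h3 : (gaussianReal 0 1).real (Set.Iic (-x)) = (gaussianReal 0 1).real (Set.Ici x) := by
    conv_lhs => rw [← h2]
    rw [map_measureReal_apply measurable_neg measurableSet_Iic]
    congr 1
    ext
    simp
  rw [h1, cdf_eq_real, h3, measureReal_def, measureReal_def, measure_congr Ioi_ae_eq_Ici]

lemma gaussianQ_mem_Icc (x : ℝ) : gaussianQ x ∈ Set.Icc (0 : ℝ) 1 := by
  rw [gaussianQ_eq_cdf]
  exact ⟨cdf_nonneg _ _, cdf_le_one _ _⟩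

/-! ### A central limit theorem for sums with signs -/

/-- Factors are exchanged one at a time; the remaining ones have norm at most 1 and do not amplify
the error. -/
lemma norm_prod_sub_prod_le {ι : Type*} (s : Finset ι) (a b : ι → ℂ)
    (ha : ∀ i ∈ s, ‖a i‖ ≤ 1) (hb : ∀ i ∈ s, ‖b i‖ ≤ 1) :
    ‖∏ i ∈ s, a i - ∏ i ∈ s, b i‖ ≤ ∑ i ∈ s, ‖a i - b i‖ := by
  classical
  induction s using Finset.induction_on with
  | empty => simp
  | insert i s hi ih =>
    rw [Finset.prod_insert hi, Finset.prod_insert hi, Finset.sum_insert hi]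
    have hs := ih (fun j hj => ha j (Finset.mem_insert_of_mem hj))
      (fun j hj => hb j (Finset.mem_insert_of_mem hj))
    have hai := ha i (Finset.mem_insert_self i s)
    have hbs : ‖∏ j ∈ s, b j‖ ≤ 1 := by
      rw [norm_prod]
      exact Finset.prod_le_one (fun _ _ => norm_nonneg _)
        (fun j hj => hb j (Finset.mem_insert_of_mem hj))
    calc ‖a i * ∏ j ∈ s, a j - b i * ∏ j ∈ s, b j‖
        = ‖(a i - b i) * ∏ j ∈ s, b j + a i * (∏ j ∈ s, a j - ∏ j ∈ s, b j)‖ := by ring_nf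
      _ ≤ ‖a i - b i‖ * ‖∏ j ∈ s, b j‖ + ‖a i‖ * ‖∏ j ∈ s, a j - ∏ j ∈ s, b j‖ := by
        simpa only [norm_mul] using norm_add_le ((a i - b i) * ∏ j ∈ s, b j)
          (a i * (∏ j ∈ s, a j - ∏ j ∈ s, b j))
      _ ≤ ‖a i - b i‖ * 1 + 1 * ∑ j ∈ s, ‖a j - b j‖ := by gcongr
      _ = _ := by ring

/-- Both laws have mean 0 and variance 1, so their second-order Taylor expansions at 0 coincide. -/
lemma charFun_sub_charFun_gaussian_isLittleO {ν : Measure ℝ} [IsProbabilityMeasure ν]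
    (h0 : ∫ x, x ∂ν = 0) (h1 : ∫ x, x ^ 2 ∂ν = 1) :
    (fun t => charFun ν t - charFun (gaussianReal 0 1) t) =o[𝓝 0] fun t : ℝ => t ^ 2 := by
  have hν := taylor_charFun_two (P := ν) (X := id) aemeasurable_id h0 h1
  have hγ0 : ∫ x, id x ∂(gaussianReal 0 1) = 0 := integral_id_gaussianReal
  have hγ1 : ∫ x, ((id : ℝ → ℝ) ^ 2) x ∂(gaussianReal 0 1) = 1 := by
    have := variance_eq_integral (μ := gaussianReal 0 1) aemeasurable_id
    rw [variance_id_gaussianReal, hγ0] at this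
    simpa using this.symm
  have hγ := taylor_charFun_two (P := gaussianReal 0 1) (X := id) aemeasurable_id hγ0 hγ1
  rw [Measure.map_id] at hν hγ
  simpa using hν.sub hγ

/-- Products of values of a centered, normalized characteristic function at `±t / √n` converge to
the Gaussian characteristic function, whatever the signs. -/
lemma tendsto_prod_charFun {ν : Measure ℝ} [IsProbabilityMeasure ν]
    (h0 : ∫ x, x ∂ν = 0) (h1 : ∫ x, x ^ 2 ∂ν = 1) {N : ℕ → ℕ} (hN : Tendsto N atTop atTop)
    (ε : ∀ k, Fin (N k) → ℝ) (hε : ∀ k i, |ε k i| = 1) (t : ℝ) :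
    Tendsto (fun k => ∏ i, charFun ν ((√(N k))⁻¹ * ε k i * t)) atTop
      (𝓝 (charFun (gaussianReal 0 1) t)) := by
  have hsq : ∀ k i, ε k i ^ 2 = 1 := fun k i => by rw [← sq_abs, hε, one_pow]
  -- The Gaussian characteristic function sees only the square of its argument, so the signs
  -- disappear.
  have hγ : ∀ᶠ k in atTop, ∏ i, charFun (gaussianReal 0 1) ((√(N k))⁻¹ * ε k i * t) =
      charFun (gaussianReal 0 1) t := by
    filter_upwards [hN.eventually_ge_atTop 1] with k hk
    have hk0 : ((N k : ℕ) : ℂ) ≠ 0 := by exact_mod_cast (by omega : N k ≠ 0)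
    have hterm : ∀ i, ((√(N k))⁻¹ * ε k i * t) ^ 2 = t ^ 2 / N k := fun i => by
      rw [mul_pow, mul_pow, hsq, inv_pow, Real.sq_sqrt (Nat.cast_nonneg _)]
      ring
    simp only [charFun_gaussianReal]
    rw [← Complex.exp_sum]
    congr 1
    have : ∀ i : Fin (N k), ((((√(N k))⁻¹ * ε k i * t : ℝ) : ℂ)) ^ 2 = (t : ℂ) ^ 2 / N k :=
      fun i => by exact_mod_cast congrArg (fun r : ℝ => (r : ℂ)) (hterm i)
    simp only [this]
    simp
    field_simp
  have hdiff : Tendsto (fun k => ∏ i, charFun ν ((√(N k))⁻¹ * ε k i * t) -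
      ∏ i, charFun (gaussianReal 0 1) ((√(N k))⁻¹ * ε k i * t)) atTop (𝓝 0) := by
    rw [Metric.tendsto_nhds]
    intro δ hδ
    -- The `N k` factors together cost at most `c * t ^ 2`; the `+ 1` keeps this below `δ` and
    -- covers `t = 0`.
    have hc : 0 < δ / (t ^ 2 + 1) := by positivity
    have hlittle := (charFun_sub_charFun_gaussian_isLittleO h0 h1).def hc
    obtain ⟨r, hr, hball⟩ := Metric.eventually_nhds_iff.1 hlittle
    have hlim : Tendsto (fun k => (√(N k))⁻¹ * |t|) atTop (𝓝 0) := by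
      rw [← zero_mul |t|]
      exact .mul_const _ (tendsto_inv_atTop_zero.comp <| Real.tendsto_sqrt_atTop.comp <|
        tendsto_natCast_atTop_atTop.comp hN)
    filter_upwards [hlim.eventually_lt_const hr] with k hk
    rw [dist_zero_right]
    have hbound : ∀ i, ‖charFun ν ((√(N k))⁻¹ * ε k i * t) -
        charFun (gaussianReal 0 1) ((√(N k))⁻¹ * ε k i * t)‖ ≤
        δ / (t ^ 2 + 1) * (t ^ 2 / N k) := by
      intro i
      have h := @hball ((√(N k))⁻¹ * ε k i * t) (by
        rw [dist_zero_right, Real.norm_eq_abs, abs_mul, abs_mul, hε, mul_one,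
          abs_of_nonneg (by positivity : (0 : ℝ) ≤ (√(N k))⁻¹)]
        exact hk)
      rwa [Real.norm_eq_abs, abs_of_nonneg (sq_nonneg _), mul_pow, mul_pow, hsq, inv_pow,
        Real.sq_sqrt (Nat.cast_nonneg _), mul_one, inv_mul_eq_div (N k : ℝ)] at h
    calc _ ≤ _ := norm_prod_sub_prod_le Finset.univ _ _
          (fun i _ => norm_charFun_le_one _) (fun i _ => norm_charFun_le_one _)
      _ ≤ ∑ i : Fin (N k), δ / (t ^ 2 + 1) * (t ^ 2 / N k) :=
          Finset.sum_le_sum fun i _ => hbound i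
      _ = δ / (t ^ 2 + 1) * (N k * (t ^ 2 / N k)) := by
          rw [Finset.sum_const, Finset.card_univ, Fintype.card_fin, nsmul_eq_mul]
          ring
      _ ≤ δ / (t ^ 2 + 1) * t ^ 2 := by
          gcongr
          rw [mul_div_assoc']
          exact div_le_of_le_mul₀ (by positivity) (by positivity) (mul_comm _ _).le
      _ < δ := by
          rw [div_mul_eq_mul_div, div_lt_iff₀ (by positivity)]
          nlinarith
  have h := hdiff.add (tendsto_const_nhds.congr' (hγ.mono fun _ h => h.symm))
  simpa using h

/-- Triangular arrays of independent variables with a common centered, normalized law, multiplied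
by arbitrary signs: the distribution functions of the normalized sums converge uniformly to the
Gaussian one. -/
theorem tendstoUniformly_cdf_signed_sum {Ω : ℕ → Type*} [∀ k, MeasurableSpace (Ω k)]
    {P : ∀ k, Measure (Ω k)} [∀ k, IsProbabilityMeasure (P k)]
    {ν : Measure ℝ} [IsProbabilityMeasure ν] (h0 : ∫ x, x ∂ν = 0) (h1 : ∫ x, x ^ 2 ∂ν = 1)
    {N : ℕ → ℕ} (hN : Tendsto N atTop atTop) {Z : ∀ k, Fin (N k) → Ω k → ℝ}
    (hZ : ∀ k i, Measurable (Z k i)) (hindep : ∀ k, iIndepFun (Z k) (P k))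
    (hlaw : ∀ k i, (P k).map (Z k i) = ν)
    (ε : ∀ k, Fin (N k) → ℝ) (hε : ∀ k i, |ε k i| = 1) :
    TendstoUniformly
      (fun k => cdf ((P k).map fun ω => ∑ i, (√(N k))⁻¹ * ε k i * Z k i ω))
      (cdf (gaussianReal 0 1)) atTop := by
  have hmeas : ∀ k, Measurable fun ω => ∑ i, (√(N k))⁻¹ * ε k i * Z k i ω := fun k =>
    Finset.measurable_fun_sum _ fun i _ => (hZ k i).const_mul _
  have hprob : ∀ k, IsProbabilityMeasure
      ((P k).map fun ω => ∑ i, (√(N k))⁻¹ * ε k i * Z k i ω) := fun k =>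
    Measure.isProbabilityMeasure_map (hmeas k).aemeasurable
  refine tendstoUniformly_cdf continuous_cdf_gaussianReal fun x => ?_
  have hchar : ∀ k t, charFun ((P k).map fun ω => ∑ i, (√(N k))⁻¹ * ε k i * Z k i ω) t =
      ∏ i, charFun ν ((√(N k))⁻¹ * ε k i * t) := by
    intro k t
    have hind : iIndepFun (fun i ω => (√(N k))⁻¹ * ε k i * Z k i ω) (P k) :=
      (hindep k).comp (fun i z => (√(N k))⁻¹ * ε k i * z) fun i => measurable_const_mul _
    rw [hind.charFun_map_fun_sum_eq_prod fun i => ((hZ k i).const_mul _).aemeasurable,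
      Finset.prod_apply]
    refine Finset.prod_congr rfl fun i _ => ?_
    rw [charFun_map_mul_comp (hZ k i).aemeasurable, hlaw]
  let μ : ℕ → ProbabilityMeasure ℝ := fun k => ⟨_, hprob k⟩
  let γ : ProbabilityMeasure ℝ := ⟨gaussianReal 0 1, inferInstance⟩
  have hweak : Tendsto μ atTop (𝓝 γ) := by
    refine ProbabilityMeasure.tendsto_iff_tendsto_charFun.2 fun t => ?_
    exact (tendsto_prod_charFun h0 h1 hN ε hε t).congr fun k => (hchar k t).symm
  have : NullSingletonClass (gaussianReal 0 1) := nullSingletonClass_gaussianReal one_ne_zero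
  have hfrontier : (gaussianReal 0 1) (frontier (Set.Iic x)) = 0 := by
    rw [frontier_Iic, measure_singleton]
  have hIic := ProbabilityMeasure.tendsto_measure_of_null_frontier_of_tendsto' hweak hfrontier
  simp only [cdf_eq_real]
  exact (ENNReal.tendsto_toReal (measure_ne_top _ _)).comp hIic

/-! ### The noise of the channel -/

instance : MeasurableSingletonClass ℤˣ where
  measurableSet_singleton u := by
    have h : ({u} : Set ℤˣ) = Units.val ⁻¹' {(u : ℤ)} := by
      ext
      simp [Units.ext_iff]
    rw [h]
    exact ⟨_, MeasurableSet.singleton _, rfl⟩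

/-- The law of the multiplicative noise of one use of the channel. -/
def flipMeasure (p : ℝ) : Measure ℤˣ :=
  ENNReal.ofReal p • Measure.dirac (-1) + ENNReal.ofReal (1 - p) • Measure.dirac 1

/-- The centered and normalized noise. -/
def stdNoise (p : ℝ) (u : ℤˣ) : ℝ := (((u : ℤ) : ℝ) - (1 - 2 * p)) / √(4 * p * (1 - p))

lemma isProbabilityMeasure_flipMeasure {p : ℝ} (hp0 : 0 < p) (hp : p < 1 / 2) :
    IsProbabilityMeasure (flipMeasure p) := by
  constructor
  simp only [flipMeasure, Measure.coe_add, Measure.coe_smul, Pi.add_apply, Pi.smul_apply,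
    measure_univ, smul_eq_mul, mul_one]
  rw [← ENNReal.ofReal_add hp0.le (by linarith)]
  simp

lemma flipMeasure_real_singleton {p : ℝ} (hp0 : 0 < p) (hp : p < 1 / 2) (u : ℤˣ) :
    (flipMeasure p).real {u} = if u = 1 then 1 - p else p := by
  rcases Int.units_eq_one_or u with rfl | rfl
  · simp [flipMeasure, measureReal_def, Set.indicator, show ((-1 : ℤˣ) = 1) ↔ False by decide,
      ENNReal.toReal_ofReal (by linarith : (0 : ℝ) ≤ 1 - p)]
  · simp [flipMeasure, measureReal_def, Set.indicator, show ((-1 : ℤˣ) = 1) ↔ False by decide,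
      show ((1 : ℤˣ) = -1) ↔ False by decide, ENNReal.toReal_ofReal hp0.le]

lemma integral_flipMeasure {p : ℝ} (hp0 : 0 < p) (hp : p < 1 / 2) (f : ℤˣ → ℝ) :
    ∫ u, f u ∂(flipMeasure p) = (1 - p) * f 1 + p * f (-1) := by
  have := isProbabilityMeasure_flipMeasure hp0 hp
  rw [integral_fintype .of_finite]
  simp [flipMeasure_real_singleton hp0 hp, UnitsInt.univ, show ((-1 : ℤˣ) = 1) ↔ False by decide]

lemma integral_map_stdNoise {p : ℝ} (hp0 : 0 < p) (hp : p < 1 / 2) :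
    ∫ x, x ∂((flipMeasure p).map (stdNoise p)) = 0 := by
  rw [integral_map (measurable_of_finite _).aemeasurable (by fun_prop),
    integral_flipMeasure hp0 hp]
  simp only [stdNoise, Units.val_one, Units.val_neg, Int.cast_one, Int.cast_neg]
  ring

/-- A `±1` variable with mean `1 - 2p` has variance `1 - (1 - 2p)² = 4p(1 - p)`. -/
lemma integral_sq_map_stdNoise {p : ℝ} (hp0 : 0 < p) (hp : p < 1 / 2) :
    ∫ x, x ^ 2 ∂((flipMeasure p).map (stdNoise p)) = 1 := by
  have hpos : 0 < 4 * p * (1 - p) := mul_pos (by linarith) (by linarith)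
  rw [integral_map (measurable_of_finite _).aemeasurable (by fun_prop),
    integral_flipMeasure hp0 hp]
  simp only [stdNoise, Units.val_one, Units.val_neg, Int.cast_one, Int.cast_neg, div_pow,
    Real.sq_sqrt hpos.le]
  have h1 : 1 - p ≠ 0 := by linarith
  field_simp
  ring

/-! ### The conditional error probability -/

/-- The error probability given that the sentiments are `x`. -/
def condErrorProb {n : ℕ} (p S : ℝ) (x : Spins n) : ℝ :=
  (Measure.pi fun _ : Fin n => flipMeasure p).real
    {f | supermajority S x ≠ detector p S (x * f)}

/-- An output symbol agrees with its input exactly when the flip is 1, so the law of the flips does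
not depend on `x`. -/
lemma channelProb_mul {n : ℕ} {p : ℝ} (hp0 : 0 < p) (hp : p < 1 / 2) (x f : Spins n) :
    channelProb p x (x * f) = (Measure.pi fun _ : Fin n => flipMeasure p).real {f} := by
  have := isProbabilityMeasure_flipMeasure hp0 hp
  rw [measureReal_def, Measure.pi_singleton, ENNReal.toReal_prod, channelProb]
  refine Finset.prod_congr rfl fun i _ => ?_
  rw [← measureReal_def, flipMeasure_real_singleton hp0 hp]
  simp

open Classical in
lemma condErrorProb_eq_sum {n : ℕ} {p : ℝ} (hp0 : 0 < p) (hp : p < 1 / 2) (S : ℝ) (x : Spins n) :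
    condErrorProb p S x =
      ∑ y : Spins n, if supermajority S x ≠ detector p S y then channelProb p x y else 0 := by
  have := isProbabilityMeasure_flipMeasure hp0 hp
  have hset : condErrorProb p S x = (Measure.pi fun _ : Fin n => flipMeasure p).real
      ↑(Finset.univ.filter fun f : Spins n => supermajority S x ≠ detector p S (x * f)) := by
    simp [condErrorProb]
  rw [hset, ← sum_measureReal_singleton, Finset.sum_filter]
  refine Fintype.sum_equiv (Equiv.mulLeft x) _ _ fun f => ?_
  rw [Equiv.coe_mulLeft, channelProb_mul hp0 hp]

lemma errorProb_eq_sum {Ω : Type*} [MeasurableSpace Ω] {P : Measure Ω} [IsProbabilityMeasure P]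
    {n : ℕ} {G : SimpleGraph (Fin n)} {β h p : ℝ} (hp0 : 0 < p) (hp : p < 1 / 2) (S : ℝ)
    {X Y : Ω → Spins n} (hXY : IsSentimentModel P G β h p X Y) :
    errorProb P p S X Y = ∑ x, P.real {ω | X ω = x} * condErrorProb p S x := by
  classical
  have hmeas : Measurable fun ω => (X ω, Y ω) := hXY.measurable_X.prodMk hXY.measurable_Y
  have hset : errorProb P p S X Y = (P.map fun ω => (X ω, Y ω)).real
      ↑(Finset.univ.filter fun z : Spins n × Spins n =>
        supermajority S z.1 ≠ detector p S z.2) := by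
    rw [map_measureReal_apply hmeas (Finset.measurableSet _), errorProb]
    simp [Set.preimage]
  rw [hset, ← sum_measureReal_singleton, Finset.sum_filter, Fintype.sum_prod_type]
  refine Finset.sum_congr rfl fun x _ => ?_
  rw [condErrorProb_eq_sum hp0 hp, Finset.mul_sum]
  refine Finset.sum_congr rfl fun y _ => ?_
  rw [mul_ite, mul_zero]
  refine if_congr Iff.rfl ?_ rfl
  rw [map_measureReal_apply hmeas (MeasurableSet.singleton _), ← hXY.law_Y]
  simp [Set.preimage]

lemma integral_comp_eq_sum {Ω : Type*} [MeasurableSpace Ω] {P : Measure Ω}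
    [IsProbabilityMeasure P] {n : ℕ} {X : Ω → Spins n} (hX : Measurable X) (g : Spins n → ℝ) :
    ∫ ω, g (X ω) ∂P = ∑ x, P.real {ω | X ω = x} * g x := by
  rw [← integral_map (f := g) hX.aemeasurable (measurable_of_finite _).aestronglyMeasurable]
  have := Measure.isProbabilityMeasure_map (μ := P) hX.aemeasurable
  rw [integral_fintype .of_finite]
  refine Finset.sum_congr rfl fun x _ => ?_
  rw [map_measureReal_apply hX (MeasurableSet.singleton _), smul_eq_mul]
  simp [Set.preimage]

lemma sum_measureReal_eq_one {Ω : Type*} [MeasurableSpace Ω] {P : Measure Ω}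
    [IsProbabilityMeasure P] {n : ℕ} {X : Ω → Spins n} (hX : Measurable X) :
    ∑ x, P.real {ω | X ω = x} = 1 := by
  simpa using (integral_comp_eq_sum (P := P) hX fun _ => 1).symm

/-- The average sentiment never equals the threshold. -/
lemma avg_ne_of_not_integer {n : ℕ} {S : ℝ} (hS : ¬ ∃ z : ℤ, (n : ℝ) * (1 + S) / 2 = z)
    (x : Spins n) : avg x ≠ S := by
  rintro rfl
  have hn : (n : ℝ) ≠ 0 := by
    intro h0
    exact hS ⟨0, by simp [h0]⟩
  -- If `avg x = S`, then `n(1+S)/2` counts the coordinates equal to `+1`.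
  refine hS ⟨∑ i, if x i = 1 then 1 else 0, ?_⟩
  have hval : ∀ i, vec x i = 2 * (if x i = 1 then 1 else 0) - 1 := by
    intro i
    rcases Int.units_eq_one_or (x i) with h | h
    · simp [vec, h]
      norm_num
    · simp [vec, h, show ((-1 : ℤˣ) = 1) ↔ False by decide]
  have hsum : ∑ i, vec x i = 2 * (∑ i, if x i = 1 then (1 : ℝ) else 0) - n := by
    simp only [hval, Finset.sum_sub_distrib, ← Finset.mul_sum]
    simp
  rw [avg, hsum]
  push_cast
  field_simp
  ring

/-- The signs with which the normalized noise enters the error event. -/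
def errorSign {n : ℕ} (S : ℝ) (x : Spins n) (i : Fin n) : ℝ :=
  ((SignType.sign (avg x - S) : SignType) : ℝ) * vec x i

lemma abs_errorSign {n : ℕ} {S : ℝ} {x : Spins n} (hx : avg x ≠ S) (i : Fin n) :
    |errorSign S x i| = 1 := by
  have h1 : |((SignType.sign (avg x - S) : SignType) : ℝ)| = 1 := by
    rcases lt_or_gt_of_ne hx with h | h
    · rw [sign_neg (by linarith)]; simp
    · rw [sign_pos (by linarith)]; simp
  have h2 : |vec x i| = 1 := by
    rcases Int.units_eq_one_or (x i) with h | h <;> simp [vec, h]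
  rw [errorSign, abs_mul, h1, h2, one_mul]

/-- As the true sign `s` is nonzero, a tie of the detector is an error, hence the non-strict
inequality. The detector statistic splits into centered noise plus the drift `(1 - 2p)(avg x - S)`,
and `s` turns the drift into an absolute value. -/
lemma error_iff {n : ℕ} {p S : ℝ} (hp0 : 0 < p) (hp : p < 1 / 2) (hn : 0 < n) {x : Spins n}
    (hx : avg x ≠ S) (f : Spins n) :
    supermajority S x ≠ detector p S (x * f) ↔
      ∑ i, (√n)⁻¹ * errorSign S x i * stdNoise p (f i) ≤ -(Dp p * √n * |avg x - S|) := by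
  have hn' : (0 : ℝ) < n := by exact_mod_cast hn
  have hσ : 0 < √(4 * p * (1 - p)) := Real.sqrt_pos.2 (mul_pos (by linarith) (by linarith))
  have hsn : 0 < √(n : ℝ) := Real.sqrt_pos.2 hn'
  set s : ℝ := ((SignType.sign (avg x - S) : SignType) : ℝ) with hs
  have hsabs : s * (avg x - S) = |avg x - S| := sign_mul_self _
  have hdec : avg (x * f) - (1 - 2 * p) * S =
      (∑ i, vec x i * (((f i : ℤ) : ℝ) - (1 - 2 * p))) / n + (1 - 2 * p) * (avg x - S) := by
    simp only [avg, mul_sub, Finset.sum_sub_distrib, ← Finset.sum_mul]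
    simp only [vec, Pi.mul_apply, Units.val_mul, Int.cast_mul]
    ring
  have hsum : ∑ i, (√n)⁻¹ * errorSign S x i * stdNoise p (f i) =
      √n / √(4 * p * (1 - p)) *
        (s * ((∑ i, vec x i * (((f i : ℤ) : ℝ) - (1 - 2 * p))) / n)) := by
    rw [Finset.sum_div, Finset.mul_sum, Finset.mul_sum]
    refine Finset.sum_congr rfl fun i _ => ?_
    have hnn : (n : ℝ) = √n * √n := (Real.mul_self_sqrt hn'.le).symm
    rw [errorSign, stdNoise, ← hs]
    conv_rhs => rw [hnn]
    simp only [Real.sqrt_mul_self hsn.le]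
    field_simp
  have hiff : (∑ i, (√n)⁻¹ * errorSign S x i * stdNoise p (f i) ≤ -(Dp p * √n * |avg x - S|)) ↔
      s * (avg (x * f) - (1 - 2 * p) * S) ≤ 0 := by
    have hfac : ∑ i, (√n)⁻¹ * errorSign S x i * stdNoise p (f i) + Dp p * √n * |avg x - S| =
        √n / √(4 * p * (1 - p)) * (s * (avg (x * f) - (1 - 2 * p) * S)) := by
      rw [hsum, hdec, ← hsabs, Dp]
      ring
    rw [le_neg_iff_add_nonpos_right, hfac, mul_nonpos_iff_pos_imp_nonpos]
    have : 0 < √n / √(4 * p * (1 - p)) := by positivity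
    constructor
    · exact fun h => h.1 this
    · exact fun h => ⟨fun _ => h, fun _ => this.le⟩
  rw [hiff, supermajority, detector]
  rcases lt_or_gt_of_ne hx with h | h
  · have hneg := sign_neg (show avg x - S < 0 by linarith)
    rw [hs, hneg, SignType.coe_neg_one, neg_one_mul, neg_nonpos, ne_comm, Ne, sign_eq_neg_one_iff,
      not_lt]
  · have hpos := sign_pos (show 0 < avg x - S by linarith)
    rw [hs, hpos, SignType.coe_one, one_mul, ne_comm, Ne, sign_eq_one_iff, not_lt]

lemma condErrorProb_eq_cdf {n : ℕ} {p S : ℝ} (hp0 : 0 < p) (hp : p < 1 / 2) (hn : 0 < n)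
    {x : Spins n} (hx : avg x ≠ S) :
    condErrorProb p S x =
      cdf ((Measure.pi fun _ : Fin n => flipMeasure p).map
        fun f => ∑ i, (√n)⁻¹ * errorSign S x i * stdNoise p (f i))
        (-(Dp p * √n * |avg x - S|)) := by
  have := isProbabilityMeasure_flipMeasure hp0 hp
  have hmeas : Measurable fun f : Spins n =>
      ∑ i, (√n)⁻¹ * errorSign S x i * stdNoise p (f i) := measurable_of_finite _
  have := Measure.isProbabilityMeasure_map
    (μ := Measure.pi fun _ : Fin n => flipMeasure p) hmeas.aemeasurable
  rw [cdf_eq_real, map_measureReal_apply hmeas measurableSet_Iic, condErrorProb]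
  congr 1
  ext f
  exact error_iff hp0 hp hn hx f

/-- The conditional error probabilities are uniformly close to their Gaussian approximations. -/
theorem eventually_forall_abs_condErrorProb_sub_lt {p S : ℝ} (hp0 : 0 < p) (hp : p < 1 / 2)
    {N : ℕ → ℕ} (hN : Tendsto N atTop atTop)
    (hNS : ∀ k, ¬ ∃ z : ℤ, (N k : ℝ) * (1 + S) / 2 = z) {ε : ℝ} (hε : 0 < ε) :
    ∀ᶠ k in atTop, ∀ x : Spins (N k),
      |condErrorProb p S x - gaussianQ (Dp p * √(N k) * |avg x - S|)| < ε := by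
  have := isProbabilityMeasure_flipMeasure hp0 hp
  have hmeas : Measurable (stdNoise p) := measurable_of_finite _
  have := Measure.isProbabilityMeasure_map (μ := flipMeasure p) hmeas.aemeasurable
  -- a worst configuration for each `k`
  have hworst : ∀ k, ∃ x₀ : Spins (N k), ∀ x : Spins (N k),
      |condErrorProb p S x - gaussianQ (Dp p * √(N k) * |avg x - S|)| ≤
        |condErrorProb p S x₀ - gaussianQ (Dp p * √(N k) * |avg x₀ - S|)| := fun k =>
    Finite.exists_max _
  choose x hx using hworst
  have hne : ∀ k, avg (x k) ≠ S := fun k => avg_ne_of_not_integer (hNS k) _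
  -- The signs may vary freely with `k`, so the CLT applies along the worst configurations.
  have huniform := tendstoUniformly_cdf_signed_sum
    (P := fun k => Measure.pi fun _ : Fin (N k) => flipMeasure p)
    (integral_map_stdNoise hp0 hp) (integral_sq_map_stdNoise hp0 hp) hN
    (Z := fun k i f => stdNoise p (f i))
    (fun k i => hmeas.comp (measurable_pi_apply i))
    (fun k => iIndepFun_pi fun i => hmeas.aemeasurable)
    (fun k i => by
      have h := (measurePreserving_eval (fun _ : Fin (N k) => flipMeasure p) i).map_eq
      exact (Measure.map_map hmeas (measurable_pi_apply i)).symm.trans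
        (congrArg (Measure.map (stdNoise p)) h))
    (fun k => errorSign S (x k)) (fun k i => abs_errorSign (hne k) i)
  filter_upwards [Metric.tendstoUniformly_iff.1 huniform ε hε, hN.eventually_gt_atTop 0]
    with k hk hk0 y
  refine (hx k y).trans_lt ?_
  rw [condErrorProb_eq_cdf hp0 hp hk0 (hne k), gaussianQ_eq_cdf, ← Real.dist_eq, dist_comm]
  -- The evaluation point depends on `k`, which is why uniform convergence is needed.
  exact hk _

end Sentiment

end

open Sentiment Topology in
theorem mainTheorem3
    (β h p S : ℝ) (hβ : 0 < β) (hp0 : 0 < p) (hp : p < 1 / 2) (hS : S ∈ Set.Ioo (-1 : ℝ) 1)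
    (N : ℕ → ℕ) (hN : Tendsto N atTop atTop)
    (hNS : ∀ k, ¬ ∃ z : ℤ, (N k : ℝ) * (1 + S) / 2 = z)
    (G : ∀ k, SimpleGraph (Fin (N k)))
    {Ω : ℕ → Type*} [∀ k, MeasurableSpace (Ω k)]
    (P : ∀ k, Measure (Ω k)) [∀ k, IsProbabilityMeasure (P k)]
    (X Y : ∀ k, Ω k → Sentiment.Spins (N k))
    (hXY : ∀ k, Sentiment.IsSentimentModel (P k) (G k) β h p (X k) (Y k)) :
    liminf (fun k => Sentiment.errorProb (P k) p S (X k) (Y k)) atTop =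
      liminf (fun k => ∫ ω, Sentiment.gaussianQ
        (Sentiment.Dp p * √(N k) * |Sentiment.avg (X k ω) - S|) ∂(P k)) atTop ∧
    limsup (fun k => Sentiment.errorProb (P k) p S (X k) (Y k)) atTop =
      limsup (fun k => ∫ ω, Sentiment.gaussianQ
        (Sentiment.Dp p * √(N k) * |Sentiment.avg (X k ω) - S|) ∂(P k)) atTop := by
  have hint : ∀ k, ∫ ω, gaussianQ (Dp p * √(N k) * |avg (X k ω) - S|) ∂(P k) =
      ∑ x, (P k).real {ω | X k ω = x} * gaussianQ (Dp p * √(N k) * |avg x - S|) := fun k =>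
    integral_comp_eq_sum (hXY k).measurable_X fun x => gaussianQ (Dp p * √(N k) * |avg x - S|)
  have hdiff : Tendsto (fun k => errorProb (P k) p S (X k) (Y k) -
      ∫ ω, gaussianQ (Dp p * √(N k) * |avg (X k ω) - S|) ∂(P k)) atTop (𝓝 0) := by
    rw [Metric.tendsto_nhds]
    intro ε hε
    filter_upwards [eventually_forall_abs_condErrorProb_sub_lt hp0 hp hN hNS (half_pos hε)]
      with k hk
    rw [dist_zero_right, Real.norm_eq_abs, hint, errorProb_eq_sum hp0 hp S (hXY k),
      ← Finset.sum_sub_distrib]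
    calc _ ≤ ∑ x, |(P k).real {ω | X k ω = x} * condErrorProb p S x -
          (P k).real {ω | X k ω = x} * gaussianQ (Dp p * √(N k) * |avg x - S|)| :=
          Finset.abs_sum_le_sum_abs _ _
      _ ≤ ∑ x, (P k).real {ω | X k ω = x} * (ε / 2) := by
          refine Finset.sum_le_sum fun x _ => ?_
          rw [← mul_sub, abs_mul, abs_of_nonneg measureReal_nonneg]
          exact mul_le_mul_of_nonneg_left (hk x).le measureReal_nonneg
      _ < ε := by
          rw [← Finset.sum_mul, sum_measureReal_eq_one (hXY k).measurable_X]
          linarith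
  have hdiff' := hdiff.neg
  simp only [neg_sub, neg_zero] at hdiff'
  -- Real liminf and limsup are meaningful only for bounded sequences; both sequences lie in `[0,
  -- 1]`.
  have hu : ∀ k, errorProb (P k) p S (X k) (Y k) ∈ Set.Icc (0 : ℝ) 1 := fun k =>
    ⟨measureReal_nonneg, measureReal_le_one⟩
  have hv : ∀ k, ∫ ω, gaussianQ (Dp p * √(N k) * |avg (X k ω) - S|) ∂(P k) ∈
      Set.Icc (0 : ℝ) 1 := fun k => by
    rw [hint]
    refine ⟨Finset.sum_nonneg fun x _ => mul_nonneg measureReal_nonneg (gaussianQ_mem_Icc _).1, ?_⟩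
    rw [← sum_measureReal_eq_one (P := P k) (hXY k).measurable_X]
    exact Finset.sum_le_sum fun x _ =>
      mul_le_of_le_one_right measureReal_nonneg (gaussianQ_mem_Icc _).2
  exact ⟨le_antisymm (liminf_le_liminf_of_tendsto_sub hdiff hu hv)
      (liminf_le_liminf_of_tendsto_sub hdiff' hv hu),
    le_antisymm (limsup_le_limsup_of_tendsto_sub hdiff hu hv)
      (limsup_le_limsup_of_tendsto_sub hdiff' hv hu)⟩
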